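/- All semigroups are nonempty. A \emph{semigroup inclusion class} is a collection of the form $[L_k\subseteq M_k]_{k=1}^t$: all semigroups $S$ such that, for every substitution of elements of $S$ for the variables and every $k$, each value of a word of $L_k$ is the value of some word of $M_k$; here $t$ is finite and the $L_k$, $M_k$ are finite sets of words over some alphabet, the $M_k$ nonempty. (For example $[xyz\in\{xywz,xqyz\};\,xy=xyxy]$; a list of identities is the special case of singletons.) Let $\mathbf 0$ be the class of one-element semigroups and put $\mathbf Z=[xy=zw]$, $\mathbf L=[xy=x]$, $\mathbf R=[xy=y]$, $\mathbf{RB}=\mathbf L\times\mathbf R$ (rectangular bands, the semigroups isomorphic to a direct product of a member of $\mathbf L$ and a member of $\mathbf R$). For a class $\mathbf V$ let $\mathbf{IV}$ be the class of inflations of members of $\mathbf V$ ($S$ is an inflation of a subsemigroup $T$ if there is a map $\varphi:S\to T$ that is the identity on $T$ and satisfies $xy=\varphi(x)\varphi(y)$ for all $x,y\in S$). For $\mathbf V\in\{\mathbf L,\mathbf R,\mathbf{RB}\}$ let $\mathbf{GV}=\{S: S^2\in\mathbf V\}$, where $S^2=\{xy:x,y\in S\}$ (the generalised inflations of members of $\mathbf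 V$). Put $\mathbf{GRB}_l=[xyz=xywz;\,xy=xyxy]$ and $\mathbf{GRB}_r=[xyz=xwyz;\,xy=xyxy]$, and let $\mathbf I=[xyz\in\{xywz,xqyz\};\,xy=xyxy]$. \textbf{Theorem.} $\mathbf I=\mathbf{GRB}_l\cup\mathbf{GRB}_r$. The inclusion classes contained in $\mathbf I$ are exactly the following 39 classes, which are pairwise distinct: \begin{itemize} \item $\mathbf 0$, $\mathbf Z$, $\mathbf L$, $\mathbf R$, $\mathbf{IL}$, $\mathbf{IR}$, $\mathbf{RB}$, $\mathbf{IRB}$, $\mathbf{GL}$, $\mathbf{GR}$, $\mathbf{GRB}_l$, $\mathbf{GRB}_r$; \item $\mathbf L\cup\mathbf R$, $\mathbf Z\cup\mathbf R$, $\mathbf L\cup\mathbf Z$, $\mathbf L\cup\mathbf Z\cup\mathbf R$, $\mathbf{IL}\cup\mathbf R$, $\mathbf L\cup\mathbf{IR}$, $\mathbf{IL}\cup\mathbf{IR}$, $\mathbf{GL}\cup\mathbf R$, $\mathbf L\cup\mathbf{GR}$, $\mathbf{GL}\cup\mathbf{IR}$, $\mathbf{IL}\cup\mathbf{GR}$,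 $\mathbf{GL}\cup\mathbf{GR}$; \item $\mathbf Z\cup\mathbf{RB}$, $\mathbf{RB}\cup\mathbf{IR}$, $\mathbf{IL}\cup\mathbf{RB}$, $\mathbf{IL}\cup\mathbf{RB}\cup\mathbf{IR}$, $\mathbf{GL}\cup\mathbf{RB}$, $\mathbf{RB}\cup\mathbf{GR}$, $\mathbf{GL}\cup\mathbf{RB}\cup\mathbf{IR}$, $\mathbf{IL}\cup\mathbf{RB}\cup\mathbf{GR}$, $\mathbf{GL}\cup\mathbf{RB}\cup\mathbf{GR}$; \item $\mathbf{GL}\cup\mathbf{IRB}$, $\mathbf{IRB}\cup\mathbf{GR}$, $\mathbf{GL}\cup\mathbf{IRB}\cup\mathbf{GR}$, $\mathbf{GRB}_l\cup\mathbf{GR}$, $\mathbf{GL}\cup\mathbf{GRB}_r$, $\mathbf{GRB}_l\cup\mathbf{GRB}_r$. \end{itemize} Order the twelve classes of the first line by the partial order whose covering pairs are $\mathbf 0<\mathbf Z,\mathbf L,\mathbf R$; $\mathbf Z,\mathbf L<\mathbf{IL}$; $\mathbf Z,\mathbf R<\mathbf{IR}$; $\mathbf L,\mathbf R<\mathbf{RB}$;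 $\mathbf{IL},\mathbf{IR},\mathbf{RB}<\mathbf{IRB}$; $\mathbf{IL}<\mathbf{GL}$; $\mathbf{IR}<\mathbf{GR}$; $\mathbf{GL},\mathbf{IRB}<\mathbf{GRB}_l$; $\mathbf{GR},\mathbf{IRB}<\mathbf{GRB}_r$. A listed union is contained in another listed union if and only if each class written in the first is $\le$ some class written in the second. These 39 classes form a lattice under inclusion, with union as join and intersection as meet, and no inclusion class lies strictly between two points adjacent in the order just described. Moreover $\mathbf{GRB}$ is a variety and each of the twelve classes of the first line is a subvariety of it, so every element of the lattice is a union of subvarieties of the variety of generalised inflations of rectangular bands. -/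

import Mathlib

universe u

namespace SgpIncl

/-- A (nonempty) semigroup in the universe `Type u`. -/
structure Sgp : Type (u + 1) where
  carrier : Type u
  [semigroup : Semigroup carrier]
  [nonempty : Nonempty carrier]

instance : CoeSort Sgp.{u} (Type u) := ⟨Sgp.carrier⟩

attribute [instance] Sgp.semigroup Sgp.nonempty

/-- `S` satisfies the inclusion `L ⊆ M` between finite sets of words over the alphabet `Ω`:
for every substitution of elements of `S` for the variables, each value of a word of `L`
is the value of some word of `M`. -/
def SatisfiesInclusion (S : Sgp.{u}) {Ω : Type} (L M : Finset (FreeSemigroup Ω)) : Prop :=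
  ∀ f : Ω → S, ∀ w ∈ L, ∃ w' ∈ M, FreeSemigroup.lift f w = FreeSemigroup.lift f w'

/-- A semigroup inclusion class: all semigroups that satisfy finitely many inclusions
`L k ⊆ M k` between finite sets of words. The right-hand sides are nonempty
(otherwise the class could be empty). -/
def IsInclusionClass (C : Set Sgp.{u}) : Prop :=
  ∃ (Ω : Type) (t : ℕ) (L M : Fin t → Finset (FreeSemigroup Ω)),
    (∀ k, (M k).Nonempty) ∧ C = {S : Sgp.{u} | ∀ k, SatisfiesInclusion S (L k) (M k)}

/-- A semigroup variety: all semigroups that satisfy a (possibly infinite) set of identities. -/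
def IsVariety (C : Set Sgp.{u}) : Prop :=
  ∃ E : Set (FreeSemigroup ℕ × FreeSemigroup ℕ),
    C = {S : Sgp.{u} | ∀ e ∈ E, ∀ f : ℕ → S, FreeSemigroup.lift f e.1 = FreeSemigroup.lift f e.2}

/-- The variety `0` of one-element semigroups. -/
def Triv : Set Sgp.{u} := {S : Sgp.{u} | ∀ x y : S, x = y}

/-- `Z`: null semigroups, `xy = zw`. -/
def Z : Set Sgp.{u} := {S : Sgp.{u} | ∀ x y z w : S, x * y = z * w}

/-- `L`: left zero semigroups, `xy = x`. -/
def L : Set Sgp.{u} := {S : Sgp.{u} | ∀ x y : S, x * y = x}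

/-- `R`: right zero semigroups, `xy = y`. -/
def R : Set Sgp.{u} := {S : Sgp.{u} | ∀ x y : S, x * y = y}

/-- `RB = L × R`: rectangular bands, the direct products (up to isomorphism) of a left zero
semigroup and a right zero semigroup. -/
def RB : Set Sgp.{u} :=
  {S : Sgp.{u} | ∃ A ∈ L.{u}, ∃ B ∈ R.{u}, Nonempty (S ≃* A × B)}

/-- A subsemigroup with at least one element, as a semigroup. -/
def ofSub (S : Sgp.{u}) (T : Subsemigroup S) (h : Nonempty T) : Sgp.{u} :=
  @Sgp.mk T inferInstance h

/-- `S` is an inflation of its subsemigroup `T`: there is a retraction `φ` of the set `S`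
onto `T` with `xy = φ(x)φ(y)`. -/
def IsInflationOf (S : Sgp.{u}) (T : Subsemigroup S) : Prop :=
  ∃ φ : S → S, (∀ x, φ x ∈ T) ∧ (∀ x ∈ T, φ x = x) ∧ ∀ x y, x * y = φ x * φ y

/-- `IV`: the inflations of semigroups in `V`. -/
def Infl (V : Set Sgp.{u}) : Set Sgp.{u} :=
  {S : Sgp.{u} | ∃ (T : Subsemigroup S) (h : Nonempty T), ofSub S T h ∈ V ∧ IsInflationOf S T}

/-- The subsemigroup `S² = {xy : x, y ∈ S}` of `S`. -/
def sq (S : Sgp.{u}) : Subsemigroup S where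
  carrier := {s | ∃ x y : S, s = x * y}
  mul_mem' := by
    rintro a b - -
    exact ⟨a, b, rfl⟩

theorem sq_nonempty (S : Sgp.{u}) : Nonempty (sq S) :=
  S.nonempty.elim fun x => ⟨⟨x * x, x, x, rfl⟩⟩

/-- The semigroups `S` with `S² ∈ V`. If `V` is a class of rectangular bands, these are
the generalised inflations of semigroups in `V`. -/
def SqIn (V : Set Sgp.{u}) : Set Sgp.{u} :=
  {S : Sgp.{u} | ofSub S (sq S) (sq_nonempty S) ∈ V}

/-- `IL`: inflations of left zero semigroups. -/
def IL : Set Sgp.{u} := Infl L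

/-- `IR`: inflations of right zero semigroups. -/
def IR : Set Sgp.{u} := Infl R

/-- `IRB`: inflations of rectangular bands. -/
def IRB : Set Sgp.{u} := Infl RB

/-- `GL = {S : S² ∈ L}`: generalised inflations of left zero semigroups. -/
def GenL : Set Sgp.{u} := SqIn L

/-- `GR = {S : S² ∈ R}`: generalised inflations of right zero semigroups. -/
def GenR : Set Sgp.{u} := SqIn R

/-- `GRB = {S : S² ∈ RB}`: generalised inflations of rectangular bands. -/
def GenRB : Set Sgp.{u} := SqIn RB

/-- `GRB_l = [xyz = xywz; xy = xyxy]`. -/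
def GRBl : Set Sgp.{u} :=
  {S : Sgp.{u} | (∀ x y z w : S, x * y * z = x * y * w * z) ∧ ∀ x y : S, x * y = x * y * x * y}

/-- `GRB_r = [xyz = xwyz; xy = xyxy]`. -/
def GRBr : Set Sgp.{u} :=
  {S : Sgp.{u} | (∀ x y z w : S, x * y * z = x * w * y * z) ∧ ∀ x y : S, x * y = x * y * x * y}

/-- `I = [xyz ∈ {xywz, xqyz}; xy = xyxy]`. -/
def I : Set Sgp.{u} :=
  {S : Sgp.{u} | (∀ x y z w q : S, x * y * z = x * y * w * z ∨ x * y * z = x * q * y * z) ∧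
    ∀ x y : S, x * y = x * y * x * y}

/-- Names of the twelve varieties that generate the diagram. -/
inductive Gen : Type
  | o | z | l | r | il | ir | rb | irb | gl | gr | grbl | grbr
  deriving DecidableEq

/-- The variety with the given name. -/
def Gen.cls : Gen → Set Sgp.{u}
  | .o => Triv
  | .z => Z
  | .l => L
  | .r => R
  | .il => IL
  | .ir => IR
  | .rb => RB
  | .irb => IRB
  | .gl => GenL
  | .gr => GenR
  | .grbl => GRBl
  | .grbr => GRBr

/-- The names of the varieties drawn below (or equal to) a given one. -/
def Gen.below : Gen → Finset Gen
  | .o => {.o}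
  | .z => {.o, .z}
  | .l => {.o, .l}
  | .r => {.o, .r}
  | .il => {.o, .z, .l, .il}
  | .ir => {.o, .z, .r, .ir}
  | .rb => {.o, .l, .r, .rb}
  | .irb => {.o, .z, .l, .r, .il, .ir, .rb, .irb}
  | .gl => {.o, .z, .l, .il, .gl}
  | .gr => {.o, .z, .r, .ir, .gr}
  | .grbl => {.o, .z, .l, .r, .il, .ir, .rb, .irb, .gl, .grbl}
  | .grbr => {.o, .z, .l, .r, .il, .ir, .rb, .irb, .gr, .grbr}

/-- The 39 points of the diagram. A point is written as the set of names of the varieties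
whose union it stands for. -/
def diagram : List (Finset Gen) :=
  [{.o}, {.z}, {.l}, {.r}, {.il}, {.ir}, {.rb}, {.irb}, {.gl}, {.gr}, {.grbl}, {.grbr},
   {.l, .r}, {.z, .r}, {.l, .z}, {.l, .z, .r},
   {.il, .r}, {.l, .ir}, {.il, .ir},
   {.gl, .r}, {.l, .gr}, {.gl, .ir}, {.il, .gr}, {.gl, .gr},
   {.z, .rb}, {.rb, .ir}, {.il, .rb}, {.il, .rb, .ir},
   {.gl, .rb}, {.rb, .gr}, {.gl, .rb, .ir}, {.il, .rb, .gr}, {.gl, .rb, .gr},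
   {.gl, .irb}, {.irb, .gr}, {.gl, .irb, .gr},
   {.grbl, .gr}, {.gl, .grbr}, {.grbl, .grbr}]

/-- The class of semigroups that a point of the diagram stands for. -/
def pointCls (p : Finset Gen) : Set Sgp.{u} := ⋃ g ∈ p, g.cls

/-- The order of the diagram: `p` lies below (or equals) `q`. -/
def PointLE (p q : Finset Gen) : Prop := ∀ g ∈ p, ∃ h ∈ q, g ∈ h.below

/-- `p` and `q` are adjacent points of the diagram, `p` below `q`. -/
def Adjacent (p q : Finset Gen) : Prop :=
  p ∈ diagram ∧ q ∈ diagram ∧ p ≠ q ∧ PointLE p q ∧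
    ∀ r ∈ diagram, PointLE p r → PointLE r q → r = p ∨ r = q

/-- The collection of all inclusion classes contained in `I`. -/
def inclusionClassesBelowI : Set (Set Sgp.{u}) := {X | IsInclusionClass X ∧ X ⊆ I}

end SgpIncl

open SgpIncl

/-!
Two facts decide the structure of the lattice.

**Separation.** Say that a semigroup `S` separates the identities of a class `g` if, for each word
`w`, one substitution of elements of `S` refutes every identity `w = m` that fails in `g`. If such an
`S` satisfies an inclusion, then for each of its left-hand words `w` some right-hand word `m` makes
`w = m` an identity of `g`; so an inclusion class that contains `S` contains all of `g`
(`Separates.cls_subset`). Every `S` in `I` belongs to one of the twelve named classes whose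
identities it separates (`exists_separates`). Indeed `I = GRBl ∪ GRBr` (`I_eq`), reversal of words
exchanges the two halves, and in `GRBl` the value of a word of length at least two depends only on
its first, second and last letters (`lift_eq_keyEval`). The least named class that contains `S` is
found by asking whether products in `S` depend on their first, second and last letters, and
whether `S` has elements that are not products; witnesses of the positive answers provide the
substitutions. Hence every inclusion class inside `I` is a union of named classes.

**Avoidance.** For each named class `g` other than the least there is an inclusion that holds in
exactly those named classes that do not lie above `g` (`Gen.cls_subset_avoid`,
`Gen.not_cls_subset_avoid`). A union of named classes is therefore the intersection of `I` with the
inclusions that avoid the named classes outside it, hence an inclusion class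
(`isInclusionClass_pointCls`). The same inclusions show that a named class contained in a union of
named classes lies below one of them (`pointCls_subset_iff`).

The inclusion classes inside `I` thus correspond to the nonempty antichains of the twelve-element
order, and these are the 39 points of the diagram.
-/

namespace SgpIncl

/-! ### The named classes as varieties -/

theorem mul_mul_eq_of_mul_mul_self {S : Type*} [Semigroup S] (h : ∀ x y : S, x * y * x = x)
    (x y z : S) : x * y * z = x * z := by
  calc x * y * z = x * y * (z * x * z) := by rw [h]
    _ = (x * (y * z) * x) * z := by simp only [mul_assoc]
    _ = x * z := by rw [h]

theorem mul_self_of_mul_mul_self {S : Type*} [Semigroup S] (h : ∀ x y : S, x * y * x = x)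
    (x : S) : x * x = x := by
  rw [← mul_mul_eq_of_mul_mul_self h x x x, h]

/-- The left zero semigroup on a nonempty type. -/
def leftZeroSgp (α : Type u) (h : Nonempty α) : Sgp.{u} where
  carrier := α
  semigroup := { mul := fun x _ => x, mul_assoc := fun _ _ _ => rfl }
  nonempty := h

/-- The right zero semigroup on a nonempty type. -/
def rightZeroSgp (α : Type u) (h : Nonempty α) : Sgp.{u} where
  carrier := α
  semigroup := { mul := fun _ y => y, mul_assoc := fun _ _ _ => rfl }
  nonempty := h

/-- A semigroup with `xyx = x` is the product of the left zero semigroup `{x | xe = x}` and the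
right zero semigroup `{x | ex = x}`, for any choice of an element `e`. -/
theorem mem_RB {S : Sgp.{u}} : S ∈ RB ↔ ∀ x y : S, x * y * x = x := by
  constructor
  · rintro ⟨A, hA, B, hB, ⟨e⟩⟩ x y
    apply e.injective
    ext
    · simp only [map_mul, Prod.fst_mul]
      rw [hA, hA]
    · simp only [map_mul, Prod.snd_mul]
      rw [hB]
  · intro h
    obtain ⟨e⟩ := S.nonempty
    have h3 := mul_mul_eq_of_mul_mul_self h
    have hi := mul_self_of_mul_mul_self h
    let A := leftZeroSgp {x : S // x * e = x} ⟨⟨e, hi e⟩⟩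
    let B := rightZeroSgp {x : S // e * x = x} ⟨⟨e, hi e⟩⟩
    refine ⟨A, fun _ _ => rfl, B, fun _ _ => rfl, ⟨?_⟩⟩
    change S ≃* leftZeroSgp {x : S // x * e = x} ⟨⟨e, hi e⟩⟩ ×
      rightZeroSgp {x : S // e * x = x} ⟨⟨e, hi e⟩⟩
    refine
      { toFun := fun x => (⟨x * e, by rw [mul_assoc, hi]⟩, ⟨e * x, by rw [← mul_assoc, hi]⟩)
        invFun := fun p => p.1.1 * p.2.1
        left_inv := fun x => ?_
        right_inv := ?_
        map_mul' := fun x y => ?_ }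
    · change x * e * (e * x) = x
      rw [← mul_assoc, mul_assoc x, hi, h]
    · rintro ⟨⟨a, ha⟩, ⟨b, hb⟩⟩
      refine Prod.ext (Subtype.ext ?_) (Subtype.ext ?_)
      · change a * b * e = a
        rw [h3, ha]
      · change e * (a * b) = b
        rw [← mul_assoc, h3, hb]
    · refine Prod.ext (Subtype.ext ?_) (Subtype.ext ?_)
      · change x * y * e = x * e
        exact h3 x y e
      · change e * (x * y) = e * y
        rw [← mul_assoc, h3]

theorem mem_IL {S : Sgp.{u}} : S ∈ IL ↔ ∀ x y z : S, x * y = x * z := by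
  constructor
  · rintro ⟨T, hT, hL, φ, h1, h2, h3⟩ x y z
    have key : ∀ a b : S, φ a * φ b = φ a := fun a b =>
      congrArg Subtype.val (hL ⟨φ a, h1 a⟩ ⟨φ b, h1 b⟩)
    rw [h3, h3 x z, key, key]
  · intro h
    refine ⟨sq S, sq_nonempty S, ?_, fun x => x * x, fun x => ⟨x, x, rfl⟩, ?_, ?_⟩
    · rintro ⟨_, a, b, rfl⟩ ⟨y, -⟩
      refine Subtype.ext ?_
      change a * b * y = a * b
      rw [mul_assoc]; exact h _ _ _
    · rintro _ ⟨a, b, rfl⟩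
      change a * b * (a * b) = a * b
      rw [mul_assoc]; exact h _ _ _
    · intro x y
      rw [mul_assoc]; exact h _ _ _

theorem mem_IR {S : Sgp.{u}} : S ∈ IR ↔ ∀ x y z : S, y * x = z * x := by
  constructor
  · rintro ⟨T, hT, hL, φ, h1, h2, h3⟩ x y z
    have key : ∀ a b : S, φ a * φ b = φ b := fun a b =>
      congrArg Subtype.val (hL ⟨φ a, h1 a⟩ ⟨φ b, h1 b⟩)
    rw [h3, h3 z x, key, key]
  · intro h
    refine ⟨sq S, sq_nonempty S, ?_, fun x => x * x, fun x => ⟨x, x, rfl⟩, ?_, ?_⟩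
    · rintro ⟨y, -⟩ ⟨_, a, b, rfl⟩
      refine Subtype.ext ?_
      change y * (a * b) = a * b
      rw [← mul_assoc]; exact h _ _ _
    · rintro _ ⟨a, b, rfl⟩
      change a * b * (a * b) = a * b
      rw [← mul_assoc]; exact h _ _ _
    · intro x y
      rw [← mul_assoc]; exact h _ _ _

theorem mem_IRB {S : Sgp.{u}} : S ∈ IRB ↔ ∀ x y z : S, x * y * z = x * z := by
  constructor
  · rintro ⟨T, hT, hB, φ, h1, h2, h3⟩ x y z
    have hT3 := mul_mul_eq_of_mul_mul_self (mem_RB.1 hB)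
    have key : φ x * φ y * φ z = φ x * φ z :=
      congrArg Subtype.val (hT3 ⟨φ x, h1 x⟩ ⟨φ y, h1 y⟩ ⟨φ z, h1 z⟩)
    rw [h3, h2 (x * y), h3 x y, key, ← h3]
    rw [h3]
    exact T.mul_mem (h1 x) (h1 y)
  · intro h
    refine ⟨sq S, sq_nonempty S, ?_, fun x => x * x, fun x => ⟨x, x, rfl⟩, ?_, ?_⟩
    · rw [mem_RB]
      rintro ⟨_, a, b, rfl⟩ ⟨y, -⟩
      refine Subtype.ext ?_
      change a * b * y * (a * b) = a * b
      simp only [← mul_assoc, h]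
    · rintro _ ⟨a, b, rfl⟩
      simp only [← mul_assoc, h]
    · intro x y
      simp only [← mul_assoc, h]

theorem mem_GenL {S : Sgp.{u}} : S ∈ GenL ↔ ∀ x y z : S, x * y * z = x * y := by
  constructor
  · intro h x y z
    have key : ∀ a b c d : S, a * b * (c * d) = a * b := fun a b c d =>
      congrArg Subtype.val (h ⟨a * b, a, b, rfl⟩ ⟨c * d, c, d, rfl⟩)
    calc x * y * z = x * y * (x * y) * z := by rw [key]
      _ = x * y * (x * (y * z)) := by simp only [mul_assoc]
      _ = x * y := by rw [key]
  · rintro h ⟨_, a, b, rfl⟩ ⟨y, -⟩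
    exact Subtype.ext (h a b y)

theorem mem_GenR {S : Sgp.{u}} : S ∈ GenR ↔ ∀ x y z : S, x * y * z = y * z := by
  constructor
  · intro h x y z
    have key : ∀ a b c d : S, a * b * (c * d) = c * d := fun a b c d =>
      congrArg Subtype.val (h ⟨a * b, a, b, rfl⟩ ⟨c * d, c, d, rfl⟩)
    calc x * y * z = x * (y * z * (y * z)) := by rw [key, mul_assoc]
      _ = x * y * z * (y * z) := by simp only [mul_assoc]
      _ = y * z := by rw [mul_assoc x y z, key]
  · rintro h ⟨y, -⟩ ⟨_, a, b, rfl⟩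
    refine Subtype.ext ?_
    change y * (a * b) = a * b
    rw [← mul_assoc, h]

theorem mem_GenRB {S : Sgp.{u}} :
    S ∈ GenRB ↔ ∀ x y z w : S, x * y * (z * w) * (x * y) = x * y := by
  refine mem_RB.trans ⟨fun h x y z w => ?_, ?_⟩
  · exact congrArg Subtype.val (h ⟨x * y, x, y, rfl⟩ ⟨z * w, z, w, rfl⟩)
  · rintro h ⟨_, a, b, rfl⟩ ⟨_, c, d, rfl⟩
    exact Subtype.ext (h a b c d)

theorem mul_mul_self_of_mem_GRBl {S : Sgp.{u}} (h : S ∈ GRBl) (x y : S) : x * y * y = x * y := by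
  rw [h.1 x y y x, ← h.2]

theorem mul_self_mul_of_mem_GRBr {S : Sgp.{u}} (h : S ∈ GRBr) (x y : S) : x * x * y = x * y := by
  rw [h.1 x x y y, ← h.2]

theorem Gen.cls_mono {g h : Gen} (hgh : g ∈ h.below) : g.cls.{u} ⊆ h.cls := by
  intro S
  -- one implication for each covering pair of the order
  have oz : S ∈ Triv → S ∈ Z := fun hS x y z w => hS _ _
  have ol : S ∈ Triv → S ∈ L := fun hS x y => hS _ _
  have or : S ∈ Triv → S ∈ R := fun hS x y => hS _ _
  have zil : S ∈ Z → S ∈ IL := fun hS => mem_IL.2 fun x y z => hS _ _ _ _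
  have zir : S ∈ Z → S ∈ IR := fun hS => mem_IR.2 fun x y z => hS _ _ _ _
  have lil : S ∈ L → S ∈ IL := fun hS => mem_IL.2 fun x y z => by rw [hS, hS]
  have rir : S ∈ R → S ∈ IR := fun hS => mem_IR.2 fun x y z => by rw [hS, hS]
  have lrb : S ∈ L → S ∈ RB := fun hS => mem_RB.2 fun x y => by rw [hS, hS]
  have rrb : S ∈ R → S ∈ RB := fun hS => mem_RB.2 fun x y => by rw [hS]
  have ilirb : S ∈ IL → S ∈ IRB := fun hS => mem_IRB.2 fun x y z => by
    rw [mul_assoc]; exact mem_IL.1 hS _ _ _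
  have irirb : S ∈ IR → S ∈ IRB := fun hS => mem_IRB.2 fun x y z => mem_IR.1 hS _ _ _
  have rbirb : S ∈ RB → S ∈ IRB := fun hS =>
    mem_IRB.2 (mul_mul_eq_of_mul_mul_self (mem_RB.1 hS))
  have ilgl : S ∈ IL → S ∈ GenL := fun hS => mem_GenL.2 fun x y z => by
    rw [mul_assoc]; exact mem_IL.1 hS _ _ _
  have irgr : S ∈ IR → S ∈ GenR := fun hS => mem_GenR.2 fun x y z => mem_IR.1 hS _ _ _
  have glgrbl : S ∈ GenL → S ∈ GRBl := fun hS => by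
    constructor <;> intros <;> simp only [mem_GenL.1 hS]
  have grgrbr : S ∈ GenR → S ∈ GRBr := fun hS => by
    constructor <;> intros <;> simp only [mem_GenR.1 hS]
  have irbgrbl : S ∈ IRB → S ∈ GRBl := fun hS => by
    constructor <;> intros <;> simp only [mem_IRB.1 hS]
  have irbgrbr : S ∈ IRB → S ∈ GRBr := fun hS => by
    constructor <;> intros <;> simp only [mem_IRB.1 hS]
  cases h <;> cases g <;> first
    | exact absurd hgh (by decide)
    | (simp only [Gen.cls]; intro hS; solve_by_elim)

/-! ### Duality -/

open MulOpposite

/-- The opposite semigroup. -/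
def Sgp.op (S : Sgp.{u}) : Sgp.{u} where
  carrier := Sᵐᵒᵖ
  nonempty := S.nonempty.map MulOpposite.op

/-- The name of the class of opposites of the members of a named class. -/
def Gen.dual : Gen → Gen
  | .o => .o
  | .z => .z
  | .l => .r
  | .r => .l
  | .il => .ir
  | .ir => .il
  | .rb => .rb
  | .irb => .irb
  | .gl => .gr
  | .gr => .gl
  | .grbl => .grbr
  | .grbr => .grbl

theorem Gen.op_mem_cls (g : Gen) (S : Sgp.{u}) : S.op ∈ g.cls ↔ S ∈ g.dual.cls := by
  let o : S → S.op := MulOpposite.op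
  have e : ∀ {p : S.op → Prop}, (∀ x, p x) ↔ ∀ x : S, p (o x) :=
    MulOpposite.op_surjective.forall
  have i : ∀ x y : S, o x = o y ↔ x = y := fun x y => MulOpposite.op_injective.eq_iff
  have m : ∀ x y : S, o x * o y = o (y * x) := fun _ _ => rfl
  cases g <;> simp only [Gen.cls, Gen.dual, mem_IL, mem_IR, mem_IRB, mem_RB, mem_GenL, mem_GenR,
    Triv, Z, L, R, GRBl, GRBr, Set.mem_ofPred_eq, e, m, i, ← mul_assoc]
  all_goals
    first
    | constructor <;> intro h <;> intros <;> apply h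
    | exact ⟨fun h => ⟨fun _ _ _ _ => h.1 _ _ _ _, fun _ _ => h.2 _ _⟩,
        fun h => ⟨fun _ _ _ _ => h.1 _ _ _ _, fun _ _ => h.2 _ _⟩⟩

/-- Reversal of words, as a map into the opposite of the free semigroup. -/
def revHom (Ω : Type) : FreeSemigroup Ω →ₙ* (FreeSemigroup Ω)ᵐᵒᵖ :=
  FreeSemigroup.lift fun x => MulOpposite.op (FreeSemigroup.of x)

theorem lift_op_revHom {S : Type*} [Semigroup S] {Ω : Type} (f : Ω → S) (w : FreeSemigroup Ω) :
    FreeSemigroup.lift (fun x => MulOpposite.op (f x)) (revHom Ω w).unop =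
      MulOpposite.op (FreeSemigroup.lift f w) := by
  induction w with
  | ih1 x => rfl
  | ih2 x y hx hy => rw [map_mul, unop_mul, map_mul, hx, hy, map_mul, op_mul]

/-! ### Separating substitutions -/

/-- `S` separates the identities of the named class `g`: for each word `w` there is a single
substitution of elements of `S` that refutes all identities `w = m` that fail in `g`. Membership
of such an `S` in an inclusion class forces all of `g` into that class. -/
def Separates (g : Gen) (S : Sgp.{u}) : Prop :=
  ∀ (Ω : Type) (w : FreeSemigroup Ω), ∃ f : Ω → S, ∀ m,
    FreeSemigroup.lift f w = FreeSemigroup.lift f m →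
      ∀ T ∈ g.cls.{u}, ∀ h : Ω → T, FreeSemigroup.lift h w = FreeSemigroup.lift h m

theorem Separates.cls_subset {g : Gen} {S : Sgp.{u}} (hS : Separates g S) {X : Set Sgp.{u}}
    (hX : IsInclusionClass X) (hSX : S ∈ X) : g.cls ⊆ X := by
  obtain ⟨Ω, t, L, M, -, rfl⟩ := hX
  intro T hT k f w hw
  obtain ⟨f', hf'⟩ := hS Ω w
  obtain ⟨m, hm, e⟩ := hSX k f' w hw
  exact ⟨m, hm, hf' m e T hT f⟩

theorem Separates.of_op {g : Gen} {S : Sgp.{u}} (hS : Separates g S.op) : Separates g.dual S := by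
  intro Ω w
  obtain ⟨f, hf⟩ := hS Ω (revHom Ω w).unop
  have key : ∀ m, FreeSemigroup.lift f (revHom Ω m).unop =
      MulOpposite.op (FreeSemigroup.lift (fun x => MulOpposite.unop (f x)) m) := fun m =>
    lift_op_revHom (fun x => MulOpposite.unop (f x)) m
  refine ⟨fun x => MulOpposite.unop (f x), fun m hm T hT h => ?_⟩
  have h1 := hf (revHom Ω m).unop (by rw [key, key, hm]) T.op ((g.op_mem_cls T).2 hT)
    (fun x => MulOpposite.op (h x))
  have h2 := (lift_op_revHom h w).symm.trans (h1.trans (lift_op_revHom h m))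
  exact MulOpposite.op_injective h2

/-- The part of a word that determines its value in a member of `GRBl`: the letter, for a word of
length one, and otherwise the first, the second and the last letter. -/
def key {Ω : Type} : FreeSemigroup Ω → Ω ⊕ Ω × Ω × Ω
  | ⟨x, []⟩ => .inl x
  | ⟨x, y :: t⟩ => .inr (x, y, (y :: t).getLast (List.cons_ne_nil y t))

/-- The value of a key under a substitution. -/
def keyEval {S : Type*} [Semigroup S] {Ω : Type} (f : Ω → S) : Ω ⊕ Ω × Ω × Ω → S
  | .inl x => f x
  | .inr (x, y, z) => f x * f y * f z

theorem lift_eq_keyEval {S : Sgp.{u}} (hS : S ∈ GRBl) {Ω : Type} (f : Ω → S)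
    (w : FreeSemigroup Ω) : FreeSemigroup.lift f w = keyEval f (key w) := by
  obtain ⟨x, _ | ⟨y, t⟩⟩ := w
  · rfl
  · rw [FreeSemigroup.lift_mk_eq_foldl]
    simp only [key, keyEval, List.foldl_cons]
    induction t using List.reverseRecOn with
    | nil => exact (mul_mul_self_of_mem_GRBl hS _ _).symm
    | append_singleton t z ih =>
      simp only [List.foldl_append, List.foldl_cons, List.foldl_nil, ih]
      rw [← hS.1]
      simp [List.getLast_cons]

theorem separates_of_keyEval {g : Gen} (hg : g.cls.{u} ⊆ GRBl) {S : Sgp.{u}} (hS : S ∈ g.cls)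
    (h : ∀ (Ω : Type) (k : Ω ⊕ Ω × Ω × Ω), ∃ f : Ω → S, ∀ k', keyEval f k = keyEval f k' →
      ∀ T ∈ g.cls.{u}, ∀ h : Ω → T, keyEval h k = keyEval h k') : Separates g S := by
  intro Ω w
  obtain ⟨f, hf⟩ := h Ω (key w)
  refine ⟨f, fun m hm T hT h => ?_⟩
  rw [lift_eq_keyEval (hg hS), lift_eq_keyEval (hg hS)] at hm
  rw [lift_eq_keyEval (hg hT), lift_eq_keyEval (hg hT)]
  exact hf _ hm T hT h

/-! ### Every member of `I` separates the identities of a class that contains it -/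

theorem Gen.cls_subset_GRBl {g : Gen} (h : g ∈ Gen.grbl.below) : g.cls.{u} ⊆ GRBl :=
  Gen.cls_mono (h := .grbl) h

theorem separates_o (S : Sgp.{u}) : Separates .o S := fun _ _ =>
  ⟨fun _ => Classical.choice S.nonempty, fun _ _ _ hT _ => hT _ _⟩

theorem separates_z {S : Sgp.{u}} (hS : S ∈ Z) (h : S ∉ Triv) : Separates .z S := by
  classical
  refine separates_of_keyEval (Gen.cls_subset_GRBl (by decide)) hS fun Ω k => ?_
  obtain ⟨s⟩ := S.nonempty
  obtain ⟨a, ha⟩ : ∃ a, a ≠ s * s := by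
    by_contra! h'
    exact h fun x y => (h' x).trans (h' y).symm
  have hp : ∀ x y, x * y ≠ a := fun x y e => ha (e.symm.trans (hS _ _ _ _))
  obtain x | ⟨x, y, z⟩ := k
  · refine ⟨fun t => if t = x then a else s * s, ?_⟩
    rintro (x' | ⟨x', y', z'⟩) e T hT h
    · by_cases hx : x' = x
      · rw [hx]
      · simp [keyEval, hx, ha] at e
    · simp only [keyEval, if_true] at e
      exact absurd e.symm (hp _ _)
  · refine ⟨fun _ => a, ?_⟩
    rintro (x' | ⟨x', y', z'⟩) e T hT h
    · exact absurd e (hp _ _)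
    · exact hT _ _ _ _

theorem separates_l {S : Sgp.{u}} (hS : S ∈ L) (h : S ∉ Triv) : Separates .l S := by
  classical
  refine separates_of_keyEval (Gen.cls_subset_GRBl (by decide)) hS fun Ω k => ?_
  obtain ⟨a, b, hab⟩ : ∃ a b : S, a ≠ b := by
    by_contra! h'
    exact h h'
  -- in a left zero semigroup a word has the value of its first letter
  have hk : ∀ T ∈ L.{u}, ∀ f : Ω → T, ∀ k, keyEval f k = f (k.elim id Prod.fst) := by
    rintro T hT f (x | ⟨x, y, z⟩)
    · rfl
    · simp only [keyEval, Sum.elim_inr]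
      rw [hT, hT]
  refine ⟨fun t => if t = k.elim id Prod.fst then a else b, fun k' e T hT h => ?_⟩
  rw [hk S hS, hk S hS] at e
  rw [hk T hT, hk T hT]
  by_cases hx : k'.elim id Prod.fst = k.elim id Prod.fst
  · rw [hx]
  · simp [hx, hab] at e

theorem separates_il {S : Sgp.{u}} (hS : S ∈ IL) (hL : S ∉ L) (hZ : S ∉ Z) :
    Separates .il S := by
  classical
  refine separates_of_keyEval (Gen.cls_subset_GRBl (by decide)) hS fun Ω k => ?_
  have h2 := mem_IL.1 hS
  have h3 : ∀ x y z : S, x * y * z = x * x := fun x y z => by rw [mul_assoc]; exact h2 _ _ _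
  obtain ⟨a, c, hac⟩ : ∃ a c : S, a * c ≠ a := by
    by_contra! h'
    exact hL h'
  have hp : ∀ x y, x * y ≠ a := fun x y e => hac (by rw [← e, h3, h2 x x y])
  obtain ⟨b, hb⟩ : ∃ b : S, b * b ≠ a * a := by
    by_contra! h'
    exact hZ fun x y z w => by rw [h2 x y x, h2 z w z, h' x, h' z]
  have hT3 : ∀ T ∈ IL.{u}, ∀ x y z : T, x * y * z = x * x := fun T hT x y z => by
    rw [mul_assoc]; exact mem_IL.1 hT _ _ _
  obtain x | ⟨x, y, z⟩ := k
  · refine ⟨fun t => if t = x then a else b * b, ?_⟩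
    rintro (x' | ⟨x', y', z'⟩) e T hT h
    · by_cases hx : x' = x
      · rw [hx]
      · simp [keyEval, hx, (hp _ _).symm] at e
    · simp only [keyEval, if_true] at e
      exact absurd e.symm (hp _ _)
  · refine ⟨fun t => if t = x then a else b * b, ?_⟩
    rintro (x' | ⟨x', y', z'⟩) e T hT h
    · exfalso
      by_cases hx : x' = x
      · simp only [keyEval, hx] at e
        exact hp _ _ e
      · simp only [keyEval, hx, h3, if_true, if_false] at e
        exact hb e.symm
    · by_cases hx : x' = x
      · simp only [keyEval, hx, hT3 T hT]
      · simp only [keyEval, hx, h3, if_true, if_false] at e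
        exact absurd e.symm hb

theorem separates_rb {S : Sgp.{u}} (hS : S ∈ RB) (hL : S ∉ L) (hR : S ∉ R) :
    Separates .rb S := by
  classical
  refine separates_of_keyEval (Gen.cls_subset_GRBl (by decide)) hS fun Ω k => ?_
  obtain ⟨p, q, hpq⟩ : ∃ p q : S, p * q ≠ p := by
    by_contra! h'
    exact hL h'
  obtain ⟨r, s, hrs⟩ : ∃ r s : S, r * s ≠ s := by
    by_contra! h'
    exact hR h'
  have h2 := mul_self_of_mul_mul_self (mem_RB.1 hS)
  have h3 := mul_mul_eq_of_mul_mul_self (mem_RB.1 hS)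
  -- in a rectangular band a word has the value of the product of its first and its last letter
  let i : Ω ⊕ Ω × Ω × Ω → Ω := Sum.elim id Prod.fst
  let j : Ω ⊕ Ω × Ω × Ω → Ω := Sum.elim id fun v => v.2.2
  have hk : ∀ T ∈ RB.{u}, ∀ f : Ω → T, ∀ k, keyEval f k = f (i k) * f (j k) := by
    rintro T hT f (x | ⟨x, y, z⟩)
    · exact (mul_self_of_mul_mul_self (mem_RB.1 hT) _).symm
    · exact mul_mul_eq_of_mul_mul_self (mem_RB.1 hT) _ _ _
  refine ⟨fun t => (if t = i k then r else s) * (if t = j k then p else q), fun k' e T hT h => ?_⟩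
  rw [hk S hS, hk S hS] at e
  rw [hk T hT, hk T hT]
  simp only [if_true, ← mul_assoc, h3] at e
  have hi : i k' = i k := by
    by_contra hx
    simp only [hx, if_false] at e
    have := congrArg (· * s) e
    simp only [h3, h2] at this
    exact hrs this
  have hj : j k' = j k := by
    by_contra hx
    simp only [hx, if_false] at e
    have := congrArg (p * ·) e
    simp only [← mul_assoc, h3, h2] at this
    exact hpq this.symm
  rw [hi, hj]

theorem separates_irb {S : Sgp.{u}} (hS : S ∈ IRB) (hL : S ∉ IL) (hR : S ∉ IR) (hB : S ∉ RB) :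
    Separates .irb S := by
  classical
  refine separates_of_keyEval (Gen.cls_subset_GRBl (by decide)) hS fun Ω k => ?_
  have h3 := mem_IRB.1 hS
  obtain ⟨a, a', ha'⟩ : ∃ a a' : S, a * a' * a ≠ a := by
    by_contra! h'
    exact hB (mem_RB.2 h')
  have ha : ∀ x y, x * y ≠ a := fun x y e => ha' (by rw [← e]; simp only [← mul_assoc, h3])
  -- `c` ends, and `d` begins, differently from `a`
  obtain ⟨c, hc⟩ : ∃ c, ∀ x, x * c ≠ x * a := by
    by_contra! h'
    refine hL (mem_IL.2 fun x y z => ?_)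
    have : ∀ y, x * y = x * a := fun y => by
      obtain ⟨t, ht⟩ := h' y
      rw [← h3 x t y, mul_assoc, ht, ← mul_assoc, h3]
    rw [this y, this z]
  obtain ⟨d, hd⟩ : ∃ d, ∀ x, d * x ≠ a * x := by
    by_contra! h'
    refine hR (mem_IR.2 fun x y z => ?_)
    have : ∀ y, y * x = a * x := fun y => by
      obtain ⟨t, ht⟩ := h' y
      rw [← h3 y t x, ht, h3]
    rw [this y, this z]
  let i : Ω ⊕ Ω × Ω × Ω → Ω := Sum.elim id Prod.fst
  let j : Ω ⊕ Ω × Ω × Ω → Ω := Sum.elim id fun v => v.2.2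
  let f : Ω → S := fun t =>
    if t = i k then (if t = j k then a else a * c) else (if t = j k then d * a else d * c)
  have hfi : ∀ t s, f t * s = (if t = i k then a else d) * s := fun t s => by
    simp only [f]; split_ifs <;> simp only [h3]
  have hfj : ∀ t s, s * f t = s * (if t = j k then a else c) := fun t s => by
    simp only [f]; split_ifs <;> simp only [← mul_assoc, h3]
  have hf : ∀ x y z, f x * f y * f z =
      (if x = i k then a else d) * (if z = j k then a else c) := fun x y z => by
    rw [h3, hfi, hfj]
  have hne : ∀ (p q : Prop) [Decidable p] [Decidable q],
      a * a = (if p then a else d) * (if q then a else c) → p ∧ q := by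
    intro p q _ _ e
    constructor
    · by_contra hp
      have := congrArg (· * a) e
      simp only [hp, if_false, h3] at this
      exact hd a this.symm
    · by_contra hq
      have := congrArg (a * ·) e
      simp only [hq, if_false, ← mul_assoc, h3] at this
      exact hc a this.symm
  have hfa : ∀ t, a * a ≠ f t := by
    intro t e
    simp only [f] at e
    split_ifs at e
    · exact ha _ _ e
    · exact hc _ e.symm
    · exact hd _ e.symm
    · exact (hne False False (by simpa only [if_false] using e)).1
  have hT3 := fun (T) (hT : T ∈ IRB.{u}) => mem_IRB.1 hT
  refine ⟨f, ?_⟩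
  obtain x | ⟨x, y, z⟩ := k
  · rintro (x' | ⟨x', y', z'⟩) e T hT h
    · by_cases hx : x' = x
      · rw [hx]
      · simp [keyEval, f, i, j, hx, (ha _ _).symm] at e
    · simp only [keyEval, f, i, j, Sum.elim_inl, id, if_true] at e
      exact absurd e.symm (ha _ _)
  · rintro (x' | ⟨x', y', z'⟩) e T hT h
    · simp only [keyEval, hf] at e
      simp only [i, j, Sum.elim_inr, if_true] at e
      exact absurd e (hfa _)
    · simp only [keyEval, hf] at e
      simp only [i, j, Sum.elim_inr, if_true] at e
      obtain ⟨hx, hz⟩ := hne _ _ e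
      simp only [keyEval, hx, hz, hT3 T hT]

theorem mul_ne_of_mem_GRBl {S : Sgp.{u}} (hS : S ∈ GRBl) {a b : S} (hab : a * b ≠ a * a * b)
    (x y : S) : x * y ≠ a := fun e => hab (by
  have h3 : ∀ x y w z : S, x * y * w * z = x * y * z := fun x y w z => (hS.1 x y z w).symm
  simp only [← e, ← mul_assoc, h3])

/-- In a member of `GRBl` with `ab ≠ aab` the first two letters `x`, `y` of a word can be recognised
from its value under a suitable substitution: `x` becomes `a`, and every other letter becomes an
element that begins with `b * b` or with `a * a`. The ends `l` of these elements are at disposal. -/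
theorem exists_recognising {S : Sgp.{u}} (hS : S ∈ GRBl) {a b : S} (hab : a * b ≠ a * a * b)
    {Ω : Type} (x y : Ω) (l : Ω → S) :
    ∃ f : Ω → S, (∀ t, f x = f t → t = x) ∧ (∀ s t, s * t ≠ f x) ∧
      (∀ s t, s * t * f x = s * t * a) ∧
      (∀ s t u, u ≠ x → s * t * f u = s * t * l u) ∧
      (∀ z t, f x * f y * f z ≠ f t) ∧
      ∀ z x' y' z', f x * f y * f z = f x' * f y' * f z' → x' = x ∧ y' = y := by
  classical
  have h2 := mul_mul_self_of_mem_GRBl hS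
  have h3 : ∀ x y w z : S, x * y * w * z = x * y * z := fun x y w z => (hS.1 x y z w).symm
  have ha := mul_ne_of_mem_GRBl hS hab
  have hb1 : b * b ≠ a * b := fun e => hab (by
    have := congrArg (a * ·) e
    simpa only [← mul_assoc, h2] using this)
  have hb2 : b * b ≠ a * a * b := fun e => hab (by
    have := congrArg (a * ·) e
    simpa only [← mul_assoc, h2, h3] using this)
  let p : Ω → S := fun t => if t = y ∨ x = y then b * b else a * a
  let f : Ω → S := fun t => if t = x then a else p t * l t
  have hfx : f x = a := if_pos rfl
  have hfb : ∀ t, t = y ∨ x = y → t ≠ x → f t = b * b * l t := fun t ht hx => by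
    simp only [f, p, ht, hx, if_true, if_false]
  have hfa : ∀ t, ¬ (t = y ∨ x = y) → t ≠ x → f t = a * a * l t := fun t ht hx => by
    simp only [f, p, ht, hx, if_false]
  -- multiplication by `b` on the right leaves visible how a product begins
  have hpair : ∀ x' y', f x * f y * b = f x' * f y' * b → x' = x ∧ y' = y := by
    intro x' y' e
    by_cases hxy : x = y
    · subst hxy
      rw [hfx] at e
      by_cases hx : x' = x
      · by_cases hy : y' = x
        · exact ⟨hx, hy⟩
        · rw [hx, hfx, hfb _ (Or.inr rfl) hy] at e
          simp only [← mul_assoc, h2, h3] at e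
          exact absurd e.symm hab
      · rw [hfb _ (Or.inr rfl) hx] at e
        simp only [h2, h3] at e
        exact absurd e.symm hb2
    · rw [hfx, hfb _ (Or.inl rfl) (Ne.symm hxy)] at e
      simp only [← mul_assoc, h2, h3] at e
      by_cases hx : x' = x
      · by_cases hy : y' = y
        · exact ⟨hx, hy⟩
        · by_cases hyx : y' = x
          · rw [hx, hyx, hfx] at e
            exact absurd e hab
          · rw [hx, hfx, hfa _ (by tauto) hyx] at e
            simp only [← mul_assoc, h3] at e
            exact absurd e hab
      · by_cases hxy' : x' = y
        · rw [hfb _ (Or.inl hxy') hx] at e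
          simp only [h2, h3] at e
          exact absurd e.symm hb1
        · rw [hfa _ (by tauto) hx] at e
          simp only [h3] at e
          exact absurd e hab
  refine ⟨f, ?_, ?_, ?_, ?_, ?_, ?_⟩
  · intro t e
    by_contra ht
    rw [hfx] at e
    simp only [f, ht, if_false] at e
    exact ha _ _ e.symm
  · rw [hfx]; exact ha
  · intro s t; rw [hfx]
  · intro s t u hu
    simp only [f, hu, if_false, p]
    split_ifs <;> simp only [← mul_assoc, h3]
  · intro z t e
    have e' := congrArg (· * b) e
    simp only [h3] at e'
    by_cases ht : t = x
    · rw [ht, hfx] at e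
      exact ha _ _ e
    by_cases ht' : t = y ∨ x = y
    · rw [hfb _ ht' ht, h3] at e'
      by_cases hxy : x = y
      · rw [← hxy, hfx, h2 b] at e'
        exact hb2 e'.symm
      · rw [hfx, hfb _ (Or.inl rfl) (Ne.symm hxy), h2 b] at e'
        simp only [← mul_assoc, h2, h3] at e'
        exact hb1 e'.symm
    · rw [hfa _ ht' ht, h3, hfx, hfb _ (Or.inl rfl) (fun h => ht' (Or.inr h.symm))] at e'
      simp only [← mul_assoc, h2, h3] at e'
      exact hab e'
  · intro z x' y' z' e
    have e' := congrArg (· * b) e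
    simp only [h3] at e'
    exact hpair x' y' e'

theorem separates_gl {S : Sgp.{u}} (hS : S ∈ GenL) (h : S ∉ IL) : Separates .gl S := by
  refine separates_of_keyEval (Gen.cls_subset_GRBl (by decide)) hS fun Ω k => ?_
  have hG : S ∈ GRBl := Gen.cls_subset_GRBl (g := .gl) (by decide) hS
  have hT3 := fun (T) (hT : T ∈ GenL.{u}) => mem_GenL.1 hT
  obtain ⟨a, b, hab⟩ : ∃ a b : S, a * b ≠ a * a * b := by
    by_contra! h'
    refine h (mem_IL.2 fun x y z => ?_)
    rw [h', h' x z, hT3 S hS, hT3 S hS]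
  obtain x | ⟨x, y, z⟩ := k
  · obtain ⟨f, h1, h2, -⟩ := exists_recognising hG hab x x fun _ => a
    refine ⟨f, ?_⟩
    rintro (x' | ⟨x', y', z'⟩) e T hT h
    · rw [h1 x' e]
    · exact absurd e.symm (h2 _ _)
  · obtain ⟨f, -, -, -, -, h5, h6⟩ := exists_recognising hG hab x y fun _ => a
    refine ⟨f, ?_⟩
    rintro (x' | ⟨x', y', z'⟩) e T hT h
    · exact absurd e (h5 _ _)
    · obtain ⟨hx, hy⟩ := h6 _ _ _ _ e
      simp only [keyEval, hx, hy, hT3 T hT]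

theorem separates_grbl {S : Sgp.{u}} (hS : S ∈ GRBl) (hL : S ∉ GenL) (hB : S ∉ IRB) :
    Separates .grbl S := by
  classical
  refine separates_of_keyEval (Gen.cls_subset_GRBl (by decide)) hS fun Ω k => ?_
  have h2 := mul_mul_self_of_mem_GRBl hS
  have h3 : ∀ x y w z : S, x * y * w * z = x * y * z := fun x y w z => (hS.1 x y z w).symm
  obtain ⟨a, b, hab⟩ : ∃ a b : S, a * b ≠ a * a * b := by
    by_contra! h'
    refine hB (mem_IRB.2 fun x y z => ?_)
    rw [mul_assoc, h', ← mul_assoc, h3, ← h']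
  obtain ⟨c, hc⟩ : ∃ c, ∀ x y, x * y * c ≠ x * y * a := by
    by_contra! h'
    refine hL (mem_GenL.2 fun x y z => ?_)
    have : ∀ z, x * y * z = x * y * a := fun z => by
      obtain ⟨s, t, e⟩ := h' z
      have := congrArg (x * y * ·) e
      simpa only [← mul_assoc, h3] using this
    rw [this z, ← this y, h2]
  obtain x | ⟨x, y, z⟩ := k
  · obtain ⟨f, h1, h2, -⟩ := exists_recognising hS hab x x fun _ => a
    refine ⟨f, ?_⟩
    rintro (x' | ⟨x', y', z'⟩) e T hT h
    · rw [h1 x' e]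
    · exact absurd e.symm (h2 _ _)
  -- As `x` becomes `a`, the letter `z` gets the end `a` if it equals `x`, and otherwise `c`.
  · obtain ⟨f, -, -, hfx, hfl, h5, h6⟩ :=
      exists_recognising hS hab x y fun t => if x = z ∨ t = z then c else a
    refine ⟨f, ?_⟩
    rintro (x' | ⟨x', y', z'⟩) e T hT h
    · exact absurd e (h5 _ _)
    · obtain ⟨hx, hy⟩ := h6 _ _ _ _ e
      have hz : z' = z := by
        by_contra hz
        simp only [keyEval, hx, hy] at e
        by_cases hxz : x = z
        · subst hxz
          rw [hfx, hfl _ _ _ hz, if_pos (Or.inl rfl)] at e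
          exact hc _ _ e.symm
        · rw [hfl _ _ _ (Ne.symm hxz), if_pos (Or.inr rfl)] at e
          by_cases hzx : z' = x
          · rw [hzx, hfx] at e
            exact hc _ _ e
          · rw [hfl _ _ _ hzx, if_neg (by tauto)] at e
            exact hc _ _ e
      rw [hx, hy, hz]

theorem exists_separates_of_mem_IL {S : Sgp.{u}} (hS : S ∈ IL) :
    ∃ g : Gen, S ∈ g.cls ∧ Separates g S := by
  by_cases h0 : S ∈ Triv
  · exact ⟨.o, h0, separates_o S⟩
  by_cases hL : S ∈ L
  · exact ⟨.l, hL, separates_l hL h0⟩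
  by_cases hZ : S ∈ Z
  · exact ⟨.z, hZ, separates_z hZ h0⟩
  exact ⟨.il, hS, separates_il hS hL hZ⟩

theorem exists_separates_of_op {S : Sgp.{u}}
    (h : ∃ g : Gen, S.op ∈ g.cls ∧ Separates g S.op) : ∃ g : Gen, S ∈ g.cls ∧ Separates g S := by
  obtain ⟨g, hg, hs⟩ := h
  exact ⟨g.dual, (g.op_mem_cls S).1 hg, hs.of_op⟩

theorem exists_separates_of_mem_GRBl {S : Sgp.{u}} (hS : S ∈ GRBl) :
    ∃ g : Gen, S ∈ g.cls ∧ Separates g S := by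
  by_cases hIL : S ∈ IL
  · exact exists_separates_of_mem_IL hIL
  by_cases hIR : S ∈ IR
  · exact exists_separates_of_op (exists_separates_of_mem_IL ((Gen.op_mem_cls .il S).2 hIR))
  by_cases hGL : S ∈ GenL
  · exact ⟨.gl, hGL, separates_gl hGL hIL⟩
  by_cases hRB : S ∈ RB
  · exact ⟨.rb, hRB,
      separates_rb hRB (fun h => hIL (Gen.cls_mono (g := .l) (h := .il) (by decide) h))
      (fun h => hIR (Gen.cls_mono (g := .r) (h := .ir) (by decide) h))⟩
  by_cases hIRB : S ∈ IRB
  · exact ⟨.irb, hIRB, separates_irb hIRB hIL hIR hRB⟩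
  exact ⟨.grbl, hS, separates_grbl hS hGL hIRB⟩

/-- In a member of `I` the products form a rectangular band. So a failure of `xyz = xywz` and a
failure of `xyz = xwyz`, even for unrelated elements, can be moved to a common middle factor, which
refutes the inclusion that defines `I`. -/
theorem I_eq : I.{u} = GRBl ∪ GRBr := by
  ext S
  constructor
  · rintro ⟨h, h2⟩
    have hi : ∀ x y : S, x * y * (x * y) = x * y := fun x y => by rw [← mul_assoc, ← h2]
    have hr : ∀ x y z w : S, x * y * (z * w) * (x * y) = x * y := fun x y z w => by
      have := h (x * y) (x * y) (x * y) (z * w) (z * w)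
      rcases this with e | e
      · rw [hi, hi] at e
        exact e.symm
      · rw [mul_assoc (x * y * (z * w)), hi, hi] at e
        exact e.symm
    by_contra hS
    obtain ⟨x, y, z, w, h1⟩ : ∃ x y z w : S, x * y * z ≠ x * y * w * z := by
      by_contra! h'
      exact hS (Or.inl ⟨h', h2⟩)
    obtain ⟨a, b, c, q, h3⟩ : ∃ a b c q : S, a * b * c ≠ a * q * b * c := by
      by_contra! h'
      exact hS (Or.inr ⟨h', h2⟩)
    rcases h a (b * c * (x * y)) z w q with e | e
    · have k : ∀ t, x * y * (a * (b * c * (x * y)) * t) = x * y * t := fun t => by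
        have := congrArg (· * t) (hr x y (a * b) c)
        simpa only [mul_assoc] using this
      rw [mul_assoc _ w z] at e
      have := congrArg (x * y * ·) e
      simp only [k] at this
      exact h1 (by rw [this, ← mul_assoc])
    · have k : ∀ t, t * (b * c * (x * y)) * z * (b * c) = t * (b * c) := fun t => by
        have := congrArg (t * ·) (hr b c (x * y) z)
        simpa only [mul_assoc] using this
      have := congrArg (· * (b * c)) e
      simp only [k] at this
      exact h3 (by rw [mul_assoc, this, ← mul_assoc])
  · rintro (h | h)
    · exact ⟨fun x y z w q => Or.inl (h.1 _ _ _ _), h.2⟩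
    · exact ⟨fun x y z w q => Or.inr (h.1 _ _ _ _), h.2⟩

theorem exists_separates {S : Sgp.{u}} (hS : S ∈ I) : ∃ g : Gen, S ∈ g.cls ∧ Separates g S := by
  rw [I_eq] at hS
  rcases hS with h | h
  · exact exists_separates_of_mem_GRBl h
  · exact exists_separates_of_op
      (exists_separates_of_mem_GRBl ((Gen.op_mem_cls .grbl S).2 h))

/-! ### Operations on inclusion classes -/

theorem isInclusionClass_univ : IsInclusionClass (Set.univ : Set Sgp.{u}) :=
  ⟨ℕ, 0, Fin.elim0, Fin.elim0, fun k => k.elim0, by ext S; simp⟩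

theorem isInclusionClass_of_word (w : FreeSemigroup ℕ) (M : List (FreeSemigroup ℕ)) (hM : M ≠ []) :
    IsInclusionClass {S : Sgp.{u} | ∀ f : ℕ → S, ∃ m ∈ M,
      FreeSemigroup.lift f w = FreeSemigroup.lift f m} := by
  classical
  refine ⟨ℕ, 1, fun _ => {w}, fun _ => M.toFinset, fun _ => ?_, ?_⟩
  · obtain ⟨m, hm⟩ := List.exists_mem_of_ne_nil M hM
    exact ⟨m, List.mem_toFinset.2 hm⟩
  · ext S
    simp [SatisfiesInclusion]

/-- Words over one alphabet, read over a larger one. -/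
def mapWord {Ω Ω' : Type} (i : Ω → Ω') : FreeSemigroup Ω →ₙ* FreeSemigroup Ω' :=
  FreeSemigroup.lift fun x => FreeSemigroup.of (i x)

theorem lift_mapWord {S : Type*} [Semigroup S] {Ω Ω' : Type} (i : Ω → Ω') (f : Ω' → S)
    (w : FreeSemigroup Ω) :
    FreeSemigroup.lift f (mapWord i w) = FreeSemigroup.lift (f ∘ i) w := by
  induction w with
  | ih1 x => rfl
  | ih2 x y hx hy => rw [map_mul, map_mul, map_mul, hx, hy]

theorem satisfiesInclusion_image {Ω Ω' : Type} [DecidableEq (FreeSemigroup Ω')]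
    {S : Sgp.{u}} {i : Ω → Ω'}
    (hi : Function.Injective i) (L M : Finset (FreeSemigroup Ω)) :
    SatisfiesInclusion S (L.image (mapWord i)) (M.image (mapWord i)) ↔
      SatisfiesInclusion S L M := by
  simp only [SatisfiesInclusion, Finset.forall_mem_image, Finset.exists_mem_image, lift_mapWord]
  refine ⟨fun h f w hw => ?_, fun h f w hw => h (f ∘ i) w hw⟩
  obtain ⟨s⟩ := S.nonempty
  have := h (Function.extend i f fun _ => s) hw
  rwa [Function.extend_comp hi] at this

theorem IsInclusionClass.inter {X Y : Set Sgp.{u}} (hX : IsInclusionClass X)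
    (hY : IsInclusionClass Y) : IsInclusionClass (X ∩ Y) := by
  classical
  obtain ⟨Ω, t, L, M, hM, rfl⟩ := hX
  obtain ⟨Ω', t', L', M', hM', rfl⟩ := hY
  refine ⟨Ω ⊕ Ω', t + t',
    Fin.addCases (fun k => (L k).image (mapWord .inl)) (fun k => (L' k).image (mapWord .inr)),
    Fin.addCases (fun k => (M k).image (mapWord .inl)) (fun k => (M' k).image (mapWord .inr)),
    fun k => ?_, ?_⟩
  · induction k using Fin.addCases with
    | left k => simpa using hM k
    | right k => simpa using hM' k
  · ext S
    simp only [Set.mem_inter_iff, Set.mem_ofPred_eq]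
    rw [Fin.forall_fin_add]
    simp only [Fin.addCases_left, Fin.addCases_right, satisfiesInclusion_image Sum.inl_injective,
      satisfiesInclusion_image Sum.inr_injective]

theorem isInclusionClass_biInter {ι : Type*} (s : Finset ι) (X : ι → Set Sgp.{u})
    (h : ∀ i ∈ s, IsInclusionClass (X i)) : IsInclusionClass (⋂ i ∈ s, X i) := by
  classical
  induction s using Finset.induction_on with
  | empty => simpa using isInclusionClass_univ
  | insert a s _ ih =>
    rw [Finset.set_biInter_insert]
    exact (h a (Finset.mem_insert_self a s)).inter
      (ih fun i hi => h i (Finset.mem_insert_of_mem hi))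

/-- Inclusion classes contain the one-element semigroups, as right-hand sides are nonempty. -/
theorem IsInclusionClass.nonempty {X : Set Sgp.{u}} (hX : IsInclusionClass X) : X.Nonempty := by
  obtain ⟨Ω, t, L, M, hM, rfl⟩ := hX
  refine ⟨leftZeroSgp PUnit ⟨⟨⟩⟩, fun k f w hw => ?_⟩
  obtain ⟨m, hm⟩ := hM k
  exact ⟨m, hm, rfl⟩

open FreeSemigroup in
theorem isInclusionClass_I : IsInclusionClass I.{u} := by
  have h := (isInclusionClass_of_word.{u} (of 0 * of 1 * of 2)
    [of 0 * of 1 * of 3 * of 2, of 0 * of 4 * of 1 * of 2] (by simp)).inter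
    (isInclusionClass_of_word (of 0 * of 1) [of 0 * of 1 * of 0 * of 1] (by simp))
  convert h using 1
  ext S
  simp only [List.mem_cons, List.not_mem_nil, or_false, exists_eq_or_imp, exists_eq_left,
    map_mul, lift_of]
  constructor
  · rintro ⟨h1, h2⟩
    exact ⟨fun f => h1 _ _ _ _ _, fun f => h2 _ _⟩
  · rintro ⟨h1, h2⟩
    exact ⟨fun x y z w q => h1 fun | 0 => x | 1 => y | 2 => z | 3 => w | _ => q,
      fun x y => h2 fun | 0 => x | _ => y⟩

/-! ### Inclusions that avoid a named class -/

instance : Fintype Gen :=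
  ⟨{.o, .z, .l, .r, .il, .ir, .rb, .irb, .gl, .gr, .grbl, .grbr}, fun g => by cases g <;> decide⟩

/-- The left-hand side of an inclusion that fails in the named class `g` but holds in all named
classes that do not lie above `g`. No such inclusion exists for the least class `o`. -/
def Gen.avoidWord : Gen → FreeSemigroup ℕ :=
  let x := FreeSemigroup.of 0
  let y := FreeSemigroup.of 1
  let z := FreeSemigroup.of 2
  fun
  | .o => x
  | .z => x
  | .l => x * y
  | .r => x * y
  | .il => x * x
  | .ir => x * x
  | .rb => x * y
  | .irb => x * y * x
  | .gl => x * y * z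
  | .gr => x * y * z
  | .grbl => x * y * z
  | .grbr => x * y * z

/-- The right-hand side of the inclusion with left-hand side `Gen.avoidWord`. For each maximal class
not above `g` it has one word, equal to the left-hand side in that class but not in `g`. -/
def Gen.avoidAlts : Gen → List (FreeSemigroup ℕ) :=
  let x := FreeSemigroup.of 0
  let y := FreeSemigroup.of 1
  let z := FreeSemigroup.of 2
  fun
  | .o => [x]
  | .z => [x * y * x]
  | .l => [y * x * y]
  | .r => [x * y * x]
  | .il => [x, y * x * x]
  | .ir => [x, x * x * y]
  | .rb => [x * y * x, y * x * y]
  | .irb => [x, x * y * y, y * y * x]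
  | .gl => [x * x * y * z]
  | .gr => [x * y * z * z]
  | .grbl => [x * y * x, x * x * y * z]
  | .grbr => [z * y * z, x * y * z * z]

/-- The semigroups that satisfy the inclusion avoiding `g`. -/
def Gen.avoid (g : Gen) : Set Sgp.{u} :=
  {S | ∀ f : ℕ → S, ∃ m ∈ g.avoidAlts, FreeSemigroup.lift f g.avoidWord = FreeSemigroup.lift f m}

theorem Gen.isInclusionClass_avoid (g : Gen) : IsInclusionClass g.avoid.{u} :=
  isInclusionClass_of_word _ _ (by cases g <;> simp [Gen.avoidAlts])

/-- The maximal named classes that do not lie above a given one. -/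
def Gen.maximalNotAbove : Gen → Finset Gen
  | .o => ∅
  | .z => {.rb}
  | .l => {.gr}
  | .r => {.gl}
  | .il => {.rb, .gr}
  | .ir => {.rb, .gl}
  | .rb => {.gl, .gr}
  | .irb => {.rb, .gl, .gr}
  | .gl => {.grbr}
  | .gr => {.grbl}
  | .grbl => {.gl, .grbr}
  | .grbr => {.gr, .grbl}

theorem Gen.cls_subset_avoid {g h : Gen} (hgh : g ∉ h.below) : h.cls.{u} ⊆ g.avoid := by
  obtain ⟨k, hk, hhk⟩ : ∃ k ∈ g.maximalNotAbove, h ∈ k.below := by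
    revert g h; decide
  refine (Gen.cls_mono hhk).trans fun S hS f => ?_
  cases g <;> simp only [Gen.maximalNotAbove, Finset.mem_insert, Finset.mem_singleton,
    Finset.notMem_empty] at hk
  all_goals
    dsimp only [Gen.avoidWord, Gen.avoidAlts]
    simp only [List.mem_cons, List.not_mem_nil, or_false,
      exists_eq_or_imp, exists_eq_left, map_mul, FreeSemigroup.lift_of]
    try rcases hk with rfl | rfl | rfl
    try rcases hk with rfl | rfl
    try subst hk
  · exact (mem_RB.1 hS _ _).symm
  · exact (mem_GenR.1 hS _ _ _).symm
  · exact (mem_GenL.1 hS _ _ _).symm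
  · exact Or.inl (mul_self_of_mul_mul_self (mem_RB.1 hS) _)
  · exact Or.inr (mem_GenR.1 hS _ _ _).symm
  · exact Or.inl (mul_self_of_mul_mul_self (mem_RB.1 hS) _)
  · exact Or.inr (mem_GenL.1 hS _ _ _).symm
  · exact Or.inl (mem_GenL.1 hS _ _ _).symm
  · exact Or.inr (mem_GenR.1 hS _ _ _).symm
  · exact Or.inl (mem_RB.1 hS _ _)
  · exact Or.inr (Or.inl (by rw [mem_GenL.1 hS, mem_GenL.1 hS]))
  · exact Or.inr (Or.inr (by rw [mem_GenR.1 hS, mem_GenR.1 hS]))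
  · exact hS.1 _ _ _ _
  · exact (mul_mul_self_of_mem_GRBl hS _ _).symm
  · exact Or.inl (by rw [mem_GenL.1 hS, mem_GenL.1 hS])
  · exact Or.inr (hS.1 _ _ _ _)
  · exact Or.inl (by rw [mem_GenR.1 hS, mem_GenR.1 hS])
  · exact Or.inr (mul_mul_self_of_mem_GRBl hS _ _).symm

/-- The elements of a semigroup that consists of a rectangular band `A × B` and one further
element. -/
inductive Ext (A B : Type u) : Type u
  | pt : Ext A B
  | pair : A → B → Ext A B

/-- The semigroup on `Ext A B` in which the further element acts on the rectangular band by a map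
`α` of the first coordinates from the left, and by a map `β` of the second coordinates from the
right, and has the square `(i, j)`. -/
def extSgp {A B : Type u} (α : A → A) (β : B → B) (i : A) (j : B) (hα : ∀ p, α (α p) = i)
    (hi : α i = i) (hβ : ∀ q, β (β q) = j) (hj : β j = j) : Sgp.{u} where
  carrier := Ext A B
  semigroup :=
    { mul := fun
        | .pt, .pt => .pair i j
        | .pt, .pair p q => .pair (α p) q
        | .pair p q, .pt => .pair p (β q)
        | .pair p _, .pair _ q => .pair p q
      mul_assoc := by
        rintro (_ | ⟨p, q⟩) (_ | ⟨p', q'⟩) (_ | ⟨p'', q''⟩)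
        · change Ext.pair i (β j) = Ext.pair (α i) j
          rw [hi, hj]
        · change Ext.pair i q'' = Ext.pair (α (α p'')) q''
          rw [hα]
        all_goals first | rfl | skip
        change Ext.pair p (β (β q)) = Ext.pair p j
        rw [hβ] }
  nonempty := ⟨.pt⟩

/-- A three-element type. -/
inductive Three : Type u
  | zero : Three
  | one : Three
  | two : Three

/-- The map `0 ↦ 0`, `1 ↦ 2`, `2 ↦ 0`, the simplest one that is not constant although its square
is. -/
def Three.shift : Three.{u} → Three.{u}
  | .zero => .zero
  | .one => .two
  | .two => .zero

theorem Three.shift_shift (p : Three.{u}) : p.shift.shift = .zero := by cases p <;> rfl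

/-- The inclusion that avoids `g` fails in `g`: it is refuted in two-element left or right zero
semigroups, in their product, or in small semigroups `extSgp`, where the further element `pt` is
substituted for the letter whose action, or whose not being a product, matters. -/
theorem Gen.not_cls_subset_avoid {g : Gen} (hg : g ≠ .o) : ¬ g.cls.{u} ⊆ g.avoid := by
  intro h
  have hno : ∀ {S : Sgp.{u}} (x y z : S), S ∈ g.cls →
      ∃ m ∈ g.avoidAlts, FreeSemigroup.lift (fun | 0 => x | 1 => y | _ => z) g.avoidWord =
        FreeSemigroup.lift (fun | 0 => x | 1 => y | _ => z : ℕ → S) m := fun x y z hS => h hS _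
  let u0 : ULift.{u} Bool := ⟨false⟩
  let u1 : ULift.{u} Bool := ⟨true⟩
  have nb : u0 ≠ u1 := fun h => Bool.noConfusion (congrArg ULift.down h)
  cases g
  case o => exact hg rfl
  all_goals
    dsimp only [Gen.avoidWord, Gen.avoidAlts] at hno
    simp only [List.mem_cons, List.not_mem_nil, or_false, exists_eq_or_imp, exists_eq_left,
      map_mul, FreeSemigroup.lift_of] at hno
  case z =>
    have := hno (S := extSgp (A := PUnit) (B := PUnit) id id ⟨⟩ ⟨⟩ (fun _ => rfl) rfl
      (fun _ => rfl) rfl) .pt .pt .pt (by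
        rintro (_ | ⟨p, q⟩) (_ | ⟨p', q'⟩) (_ | ⟨p'', q''⟩) (_ | ⟨p₁, q₁⟩) <;> rfl)
    cases this
  case l =>
    have := hno (S := leftZeroSgp (ULift Bool) ⟨u0⟩) u0 u1 u0 fun _ _ => rfl
    exact nb this
  case r =>
    have := hno (S := rightZeroSgp (ULift Bool) ⟨u0⟩) u0 u1 u0 fun _ _ => rfl
    exact nb this.symm
  case il =>
    have := hno (S := extSgp (A := ULift Bool) (B := PUnit) (fun _ => u0) id u0 ⟨⟩ (fun _ => rfl)
      rfl (fun _ => rfl) rfl) .pt (.pair u1 ⟨⟩) .pt (mem_IL.2 (by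
        rintro (_ | ⟨p, q⟩) (_ | ⟨p', q'⟩) (_ | ⟨p'', q''⟩) <;> rfl))
    rcases this with this | this
    · cases this
    · exact nb (Ext.pair.inj this).1
  case ir =>
    have := hno (S := extSgp (A := PUnit) (B := ULift Bool) id (fun _ => u0) ⟨⟩ u0 (fun _ => rfl)
      rfl (fun _ => rfl) rfl) .pt (.pair ⟨⟩ u1) .pt (mem_IR.2 (by
        rintro (_ | ⟨p, q⟩) (_ | ⟨p', q'⟩) (_ | ⟨p'', q''⟩) <;> rfl))
    rcases this with this | this
    · cases this
    · exact nb (Ext.pair.inj this).2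
  case rb =>
    let S : Sgp.{u} :=
      ⟨leftZeroSgp (ULift.{u} Bool) ⟨u0⟩ × rightZeroSgp (ULift.{u} Bool) ⟨u0⟩⟩
    have := hno (S := S) (u0, u1) (u1, u0) (u0, u0)
      ⟨_, fun _ _ => rfl, _, fun _ _ => rfl, ⟨MulEquiv.refl _⟩⟩
    rcases this with this | this
    · exact nb (congrArg Prod.snd this)
    · exact nb (congrArg Prod.fst this)
  case irb =>
    have := hno (S := extSgp (A := ULift Bool) (B := ULift Bool) (fun _ => u0) (fun _ => u0) u0 u0
      (fun _ => rfl) rfl (fun _ => rfl) rfl) .pt (.pair u1 u1) .pt (mem_IRB.2 (by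
        rintro (_ | ⟨p, q⟩) (_ | ⟨p', q'⟩) (_ | ⟨p'', q''⟩) <;> rfl))
    rcases this with this | this | this
    · cases this
    · exact nb (Ext.pair.inj this).2
    · exact nb (Ext.pair.inj this).1
  case gl =>
    have := hno (S := extSgp (A := Three) (B := PUnit) Three.shift id .zero ⟨⟩ Three.shift_shift
      rfl (fun _ => rfl) rfl) .pt (.pair .one ⟨⟩) .pt (mem_GenL.2 (by
        rintro (_ | ⟨p, q⟩) (_ | ⟨p', q'⟩) (_ | ⟨p'', q''⟩) <;> rfl))
    cases (Ext.pair.inj this).1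
  case gr =>
    have := hno (S := extSgp (A := PUnit) (B := Three) id Three.shift ⟨⟩ .zero (fun _ => rfl)
      rfl Three.shift_shift rfl) .pt (.pair ⟨⟩ .one) .pt (mem_GenR.2 (by
        rintro (_ | ⟨p, _ | _ | _⟩) (_ | ⟨p', q'⟩) (_ | ⟨p'', q''⟩) <;> rfl))
    cases (Ext.pair.inj this).2
  case grbl =>
    have := hno (S := extSgp (A := Three) (B := ULift Bool) Three.shift (fun _ => u0) .zero u0
      Three.shift_shift rfl (fun _ => rfl) rfl) .pt (.pair .one u1) (.pair .one u1) ⟨by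
        rintro (_ | ⟨p, q⟩) (_ | ⟨p', q'⟩) (_ | ⟨p'', q''⟩) (_ | ⟨p₁, q₁⟩) <;> rfl, by
        rintro (_ | ⟨p, q⟩) (_ | ⟨p', q'⟩) <;> rfl⟩
    rcases this with this | this
    · exact nb (Ext.pair.inj this).2.symm
    · cases (Ext.pair.inj this).1
  case grbr =>
    have := hno (S := extSgp (A := ULift Bool) (B := Three) (fun _ => u0) Three.shift u0 .zero
      (fun _ => rfl) rfl Three.shift_shift rfl) (.pair u1 .one) (.pair u1 .one) .pt ⟨by
        rintro (_ | ⟨p, _ | _ | _⟩) (_ | ⟨p', q'⟩) (_ | ⟨p'', q''⟩) (_ | ⟨p₁, _ | _ | _⟩) <;>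
          rfl, by
        rintro (_ | ⟨p, _ | _ | _⟩) (_ | ⟨p', q'⟩) <;> rfl⟩
    rcases this with this | this
    · exact nb (Ext.pair.inj this).1.symm
    · cases (Ext.pair.inj this).2

/-! ### The diagram -/

theorem mem_pointCls {p : Finset Gen} {S : Sgp.{u}} :
    S ∈ pointCls p ↔ ∃ g ∈ p, S ∈ g.cls := by
  simp [pointCls]

theorem Gen.below_refl (g : Gen) : g ∈ g.below := by
  cases g <;> decide

theorem Gen.below_trans {a b c : Gen} : a ∈ b.below → b ∈ c.below → a ∈ c.below := by
  revert a b c; decide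

theorem Gen.below_antisymm {a b : Gen} : a ∈ b.below → b ∈ a.below → a = b := by
  revert a b; decide

theorem pointCls_mono {p q : Finset Gen} (h : PointLE p q) : pointCls.{u} p ⊆ pointCls q := by
  intro S hS
  obtain ⟨g, hg, hS⟩ := mem_pointCls.1 hS
  obtain ⟨k, hk, hgk⟩ := h g hg
  exact mem_pointCls.2 ⟨k, hk, Gen.cls_mono hgk hS⟩

theorem pointCls_subset_iff {p q : Finset Gen} (hq : q.Nonempty) :
    pointCls.{u} p ⊆ pointCls q ↔ PointLE p q := by
  refine ⟨fun h g hg => ?_, pointCls_mono⟩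
  by_contra! hgq
  have hg0 : g ≠ .o := by
    rintro rfl
    obtain ⟨k, hk⟩ := hq
    exact hgq k hk (by cases k <;> decide)
  refine Gen.not_cls_subset_avoid.{u} hg0 fun S hS => ?_
  obtain ⟨k, hk, hSk⟩ := mem_pointCls.1 (h (mem_pointCls.2 ⟨g, hg, hS⟩))
  exact Gen.cls_subset_avoid (hgq k hk) hSk

theorem pointCls_subset_I (p : Finset Gen) : pointCls.{u} p ⊆ I := by
  rw [I_eq]
  refine (pointCls_mono (q := {.grbl, .grbr}) fun g _ => by cases g <;> decide).trans fun S hS => ?_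
  obtain ⟨g, hg, hS⟩ := mem_pointCls.1 hS
  rcases Finset.mem_insert.1 hg with rfl | hg
  · exact Or.inl hS
  · rw [Finset.mem_singleton.1 hg] at hS
    exact Or.inr hS

/-- A union of named classes is cut out of `I` by the inclusions that avoid the named classes not
contained in it. -/
theorem isInclusionClass_pointCls {p : Finset Gen} (hp : p.Nonempty) :
    IsInclusionClass (pointCls.{u} p) := by
  have h := isInclusionClass_I.inter (isInclusionClass_biInter.{u}
    (Finset.univ.filter fun g : Gen => ∀ h ∈ p, g ∉ h.below) Gen.avoid
    fun g _ => g.isInclusionClass_avoid)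
  convert h using 1
  ext S
  simp only [Set.mem_inter_iff, Set.mem_iInter, Finset.mem_filter, Finset.mem_univ, true_and]
  constructor
  · intro hS
    refine ⟨pointCls_subset_I p hS, fun g hg => ?_⟩
    obtain ⟨k, hk, hSk⟩ := mem_pointCls.1 hS
    exact Gen.cls_subset_avoid (hg k hk) hSk
  · rintro ⟨hS, hav⟩
    obtain ⟨g, hSg, hsep⟩ := exists_separates hS
    by_cases hg : ∃ k ∈ p, g ∈ k.below
    · obtain ⟨k, hk, hgk⟩ := hg
      exact mem_pointCls.2 ⟨k, hk, Gen.cls_mono hgk hSg⟩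
    · push Not at hg
      have hg0 : g ≠ .o := by
        rintro rfl
        obtain ⟨k, hk⟩ := hp
        exact hg k hk (by cases k <;> decide)
      exact absurd (hsep.cls_subset g.isInclusionClass_avoid (hav g hg))
        (Gen.not_cls_subset_avoid hg0)

/-- A decidable property of all points of the diagram, checked along the list. The quantifier
`∀ p ∈ diagram` itself would be decided by running through all finite sets of names. -/
theorem forall_mem_diagram {P : Finset Gen → Prop} [DecidablePred P]
    (h : (diagram.all fun p => decide (P p)) = true) {p : Finset Gen} (hp : p ∈ diagram) : P p :=
  of_decide_eq_true (List.all_eq_true.1 h p hp)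

theorem nonempty_of_mem_diagram {p : Finset Gen} (hp : p ∈ diagram) : p.Nonempty :=
  forall_mem_diagram (P := Finset.Nonempty) (by decide +kernel) hp

theorem antichain_of_mem_diagram {p : Finset Gen} (hp : p ∈ diagram) :
    ∀ g ∈ p, ∀ h ∈ p, g ∈ h.below → g = h :=
  forall_mem_diagram (P := fun p => ∀ g ∈ p, ∀ h ∈ p, g ∈ h.below → g = h) (by decide +kernel) hp

theorem eq_of_pointLE {p q : Finset Gen} (hp : p ∈ diagram) (hq : q ∈ diagram)
    (hpq : PointLE p q) (hqp : PointLE q p) : p = q := by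
  have key : ∀ {p q : Finset Gen}, p ∈ diagram → PointLE p q → PointLE q p → p ⊆ q := by
    intro p q hp hpq hqp g hg
    obtain ⟨h, hh, hgh⟩ := hpq g hg
    obtain ⟨k, hk, hhk⟩ := hqp h hh
    obtain rfl := antichain_of_mem_diagram hp g hg k hk (Gen.below_trans hgh hhk)
    rwa [Gen.below_antisymm hgh hhk]
  exact (key hp hpq hqp).antisymm (key hq hqp hpq)

theorem pointCls_injOn {p q : Finset Gen} (hp : p ∈ diagram) (hq : q ∈ diagram)
    (h : pointCls.{u} p = pointCls q) : p = q :=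
  eq_of_pointLE hp hq ((pointCls_subset_iff (nonempty_of_mem_diagram hq)).1 h.subset)
    ((pointCls_subset_iff (nonempty_of_mem_diagram hp)).1 h.superset)

/-- Adding a class to a point of the diagram, unless it lies below that point already, and
discarding the classes below it leads to a point of the diagram. -/
theorem insert_filter_mem_diagram (g : Gen) {p : Finset Gen} (hp : p ∈ diagram)
    (h : ∀ a ∈ p, g ∉ a.below) : insert g (p.filter (· ∉ g.below)) ∈ diagram :=
  forall_mem_diagram (P := fun p => ∀ g : Gen, (∀ a ∈ p, g ∉ a.below) →
    insert g (p.filter (· ∉ g.below)) ∈ diagram) (by decide +kernel) hp g h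

theorem exists_diagram_of_nonempty {s : Finset Gen} (hs : s.Nonempty) :
    ∃ p ∈ diagram, pointCls.{u} s = pointCls p := by
  induction hs using Finset.Nonempty.cons_induction with
  | singleton g => exact ⟨{g}, by revert g; decide, rfl⟩
  | cons g s hg _ ih =>
    obtain ⟨p, hp, e⟩ := ih
    have e' : pointCls.{u} (Finset.cons g s hg) = g.cls ∪ pointCls p := by
      rw [Finset.cons_eq_insert, pointCls, Finset.set_biUnion_insert, ← pointCls, e]
    by_cases h : ∃ a ∈ p, g ∈ a.below
    · obtain ⟨a, ha, hga⟩ := h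
      exact ⟨p, hp, e'.trans (Set.union_eq_self_of_subset_left fun S hS =>
        mem_pointCls.2 ⟨a, ha, Gen.cls_mono hga hS⟩)⟩
    · push Not at h
      refine ⟨_, insert_filter_mem_diagram g hp h, e'.trans ?_⟩
      rw [pointCls, pointCls, ← Finset.set_biUnion_insert, ← pointCls, ← pointCls]
      refine (pointCls_mono fun a ha => ?_).antisymm
        (pointCls_mono fun a ha => ⟨a, ?_, a.below_refl⟩)
      · by_cases hag : a ∈ g.below
        · exact ⟨g, Finset.mem_insert_self _ _, hag⟩
        · refine ⟨a, Finset.mem_insert_of_mem (Finset.mem_filter.2 ⟨?_, hag⟩), a.below_refl⟩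
          exact (Finset.mem_insert.1 ha).resolve_left fun h => hag (h ▸ g.below_refl)
      · exact Finset.insert_subset_insert _ (Finset.filter_subset _ _) ha

theorem mem_inclusionClassesBelowI {X : Set Sgp.{u}} :
    X ∈ inclusionClassesBelowI ↔ ∃ p ∈ diagram, X = pointCls p := by
  classical
  constructor
  · rintro ⟨hX, hXI⟩
    have hsep : ∀ S ∈ X, ∃ g : Gen, S ∈ g.cls ∧ g.cls ⊆ X := fun S hS => by
      obtain ⟨g, hg, h⟩ := exists_separates (hXI hS)
      exact ⟨g, hg, h.cls_subset hX hS⟩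
    let s : Finset Gen := Finset.univ.filter fun g => g.cls ⊆ X
    have hs : s.Nonempty := by
      obtain ⟨S, hS⟩ := hX.nonempty
      obtain ⟨g, -, hg⟩ := hsep S hS
      exact ⟨g, by simpa [s] using hg⟩
    obtain ⟨p, hp, e⟩ := exists_diagram_of_nonempty.{u} hs
    refine ⟨p, hp, e ▸ ?_⟩
    ext S
    constructor
    · intro hS
      obtain ⟨g, hSg, hg⟩ := hsep S hS
      exact mem_pointCls.2 ⟨g, by simpa [s] using hg, hSg⟩
    · intro hS
      obtain ⟨g, hg, hSg⟩ := mem_pointCls.1 hS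
      exact (Finset.mem_filter.1 hg).2 hSg
  · rintro ⟨p, hp, rfl⟩
    exact ⟨isInclusionClass_pointCls (nonempty_of_mem_diagram hp), pointCls_subset_I p⟩

theorem ncard_inclusionClassesBelowI : (inclusionClassesBelowI.{u}).ncard = 39 := by
  have h : inclusionClassesBelowI.{u} = pointCls '' (diagram.toFinset : Set (Finset Gen)) := by
    ext X
    simp only [mem_inclusionClassesBelowI, Set.mem_image, List.coe_toFinset, Set.mem_ofPred_eq,
      eq_comm]
  rw [h, Set.InjOn.ncard_image, Set.ncard_coe_finset]
  · decide
  · intro p hp q hq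
    simp only [List.coe_toFinset, Set.mem_ofPred_eq] at hp hq
    exact pointCls_injOn hp hq

/-! ### Varieties -/

open FreeSemigroup

theorem isVariety_GenRB : IsVariety GenRB.{u} := by
  refine ⟨{(of 0 * of 1 * (of 2 * of 3) * (of 0 * of 1), of 0 * of 1)}, ?_⟩
  ext S
  simp only [mem_GenRB, Set.mem_ofPred_eq, Set.mem_singleton_iff, forall_eq, map_mul, lift_of]
  exact ⟨fun h f => h _ _ _ _, fun h x y z w => h fun | 0 => x | 1 => y | 2 => z | _ => w⟩

theorem Gen.cls_subset_GenRB (g : Gen) : g.cls.{u} ⊆ GenRB := by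
  have hl : GRBl.{u} ⊆ GenRB := fun S hS => mem_GenRB.2 fun x y z w => by
    have h3 : ∀ x y w z : S, x * y * w * z = x * y * z := fun x y w z => (hS.1 x y z w).symm
    simp only [← mul_assoc, h3, mul_mul_self_of_mem_GRBl hS]
  have hr : GRBr.{u} ⊆ GenRB := fun S hS => mem_GenRB.2 fun x y z w => by
    have h3 : ∀ x w y z : S, x * w * y * z = x * y * z := fun x w y z => (hS.1 x y z w).symm
    simp only [← mul_assoc, h3, mul_self_mul_of_mem_GRBr hS]
  by_cases h : g ∈ Gen.grbl.below
  · exact (Gen.cls_mono h).trans hl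
  · exact (Gen.cls_mono (h := .grbr) (by revert g; decide)).trans hr

theorem Gen.isVariety_cls (g : Gen) : IsVariety g.cls.{u} := by
  let E : Gen → Set (FreeSemigroup ℕ × FreeSemigroup ℕ) := fun
    | .o => {(of 0, of 1)}
    | .z => {(of 0 * of 1, of 2 * of 3)}
    | .l => {(of 0 * of 1, of 0)}
    | .r => {(of 0 * of 1, of 1)}
    | .il => {(of 0 * of 1, of 0 * of 2)}
    | .ir => {(of 1 * of 0, of 2 * of 0)}
    | .rb => {(of 0 * of 1 * of 0, of 0)}
    | .irb => {(of 0 * of 1 * of 2, of 0 * of 2)}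
    | .gl => {(of 0 * of 1 * of 2, of 0 * of 1)}
    | .gr => {(of 0 * of 1 * of 2, of 1 * of 2)}
    | .grbl => {(of 0 * of 1 * of 2, of 0 * of 1 * of 3 * of 2),
        (of 0 * of 1, of 0 * of 1 * of 0 * of 1)}
    | .grbr => {(of 0 * of 1 * of 2, of 0 * of 3 * of 1 * of 2),
        (of 0 * of 1, of 0 * of 1 * of 0 * of 1)}
  refine ⟨E g, ?_⟩
  ext S
  cases g <;> simp only [Gen.cls, E, Triv, Z, L, R, GRBl, GRBr, mem_IL, mem_IR, mem_RB, mem_IRB,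
    mem_GenL, mem_GenR, Set.mem_ofPred_eq, Set.mem_singleton_iff, Set.mem_insert_iff,
    forall_eq_or_imp, forall_eq, map_mul, lift_of]
  all_goals first
    | exact ⟨fun h f => h _ _, fun h x y => h fun | 0 => x | _ => y⟩
    | exact ⟨fun h f => h _ _ _, fun h x y z => h fun | 0 => x | 1 => y | _ => z⟩
    | exact ⟨fun h f => h _ _ _ _, fun h x y z w => h fun | 0 => x | 1 => y | 2 => z | _ => w⟩
    | exact ⟨fun h => ⟨fun f => h.1 _ _ _ _, fun f => h.2 _ _⟩, fun h =>
        ⟨fun x y z w => h.1 fun | 0 => x | 1 => y | 2 => z | _ => w,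
          fun x y => h.2 fun | 0 => x | _ => y⟩⟩

end SgpIncl

open SgpIncl
theorem theorem30 :
    -- the inclusion classes contained in `I` are exactly the points of the diagram
    (∀ X : Set Sgp.{u}, X ∈ inclusionClassesBelowI ↔ ∃ p ∈ diagram, X = pointCls p) ∧
    -- they are pairwise distinct, and their inclusions are those of the diagram
    (∀ p ∈ diagram, ∀ q ∈ diagram, pointCls.{u} p = pointCls q → p = q) ∧
    (∀ p ∈ diagram, ∀ q ∈ diagram, pointCls.{u} p ⊆ pointCls q ↔ PointLE p q) ∧
    (inclusionClassesBelowI.{u}).ncard = 39 ∧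
    -- the top point is `I`
    I.{u} = GRBl ∪ GRBr ∧
    -- they form a lattice under inclusion, with union as join and intersection as meet
    (∀ X ∈ inclusionClassesBelowI.{u}, ∀ Y ∈ inclusionClassesBelowI.{u},
      X ∪ Y ∈ inclusionClassesBelowI ∧ X ∩ Y ∈ inclusionClassesBelowI) ∧
    -- no inclusion class lies strictly between two adjacent points
    (∀ p q : Finset Gen, Adjacent p q →
      ¬ ∃ X : Set Sgp.{u}, IsInclusionClass X ∧ pointCls p ⊂ X ∧ X ⊂ pointCls q) ∧
    -- generalised inflations of rectangular bands form a variety, and every generator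
    -- of the diagram is a subvariety of it
    IsVariety GenRB.{u} ∧
    (∀ g : Gen, IsVariety g.cls.{u} ∧ g.cls.{u} ⊆ GenRB) := by
  refine ⟨fun X => mem_inclusionClassesBelowI, fun p hp q hq => pointCls_injOn hp hq,
    fun p _ q hq => pointCls_subset_iff (nonempty_of_mem_diagram hq),
    ncard_inclusionClassesBelowI, I_eq, ?_, ?_, isVariety_GenRB,
    fun g => ⟨g.isVariety_cls, g.cls_subset_GenRB⟩⟩
  · rintro X hX Y hY
    refine ⟨?_, hX.1.inter hY.1, Set.inter_subset_left.trans hX.2⟩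
    obtain ⟨p, hp, rfl⟩ := mem_inclusionClassesBelowI.1 hX
    obtain ⟨q, -, rfl⟩ := mem_inclusionClassesBelowI.1 hY
    have e : pointCls.{u} p ∪ pointCls q = pointCls (p ∪ q) := by
      simp only [pointCls, Finset.set_biUnion_union]
    rw [mem_inclusionClassesBelowI, e]
    exact exists_diagram_of_nonempty ((nonempty_of_mem_diagram hp).mono Finset.subset_union_left)
  · rintro p q ⟨hp, hq, -, -, hadj⟩ ⟨X, hX, hpX, hXq⟩
    obtain ⟨r, hr, rfl⟩ := mem_inclusionClassesBelowI.1
      ⟨hX, hXq.subset.trans (pointCls_subset_I q)⟩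
    rcases hadj r hr ((pointCls_subset_iff (nonempty_of_mem_diagram hr)).1 hpX.subset)
      ((pointCls_subset_iff (nonempty_of_mem_diagram hq)).1 hXq.subset) with rfl | rfl
    · exact hpX.ne rfl
    · exact hXq.ne rfl
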